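/- Let $n\ge 1$ and $d_1,\dots,d_n\ge 1$ be integers, $D=\max_i d_i$, and let $\mathcal H_{(d)}$ be the space of systems $f=(f_1,\dots,f_n)$ with $f_i\in\mathbb C[X_0,\dots,X_n]$ homogeneous of degree $d_i$, with the Bombieri–Weyl norm $$\|f\|^2=\sum_{i=1}^n\ \sum_{|\alpha|=d_i}\binom{d_i}{\alpha}^{-1}|f_{i,\alpha}|^2,\qquad f_i=\sum_\alpha f_{i,\alpha}X^\alpha .$$ For $f\in\mathbb P(\mathcal H_{(d)})$ and $x\in\mathbb P(\mathbb C^{n+1})$ (written through representatives) let $x^\perp$ be the Hermitian complement of $x$, and put $$\mu_{\rm norm}(f,x)=\|f\|\,\bigl\|(Df(x)|_{x^\perp})^{-1}\,\mathrm{diag}\bigl(d_i^{1/2}\|x\|^{d_i-1}\bigr)\bigr\|\quad(\text{operator norm}),$$ with $\mu_{\rm norm}(f,x)=\infty$ if $Df(x)|_{x^\perp}$ is not invertible. Let $$N_f(x)=x-(Df(x)|_{x^\perp})^{-1}f(x)$$ be the projective Newton iteration, a partial map of $\mathbb P(\mathbb C^{n+1})$ to itself defined where $Df(x)|_{x^\perp}$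 is invertible. Let $d(x,y)=\arccos\frac{|\langle x,y\rangle|}{\|x\|\|y\|}$ be the Riemannian (angle) distance on $\mathbb P(\mathbb C^{n+1})$. Let $\psi(u)=1-4u+2u^2$ and let $u_0=\frac{16-\sqrt{224}}{16}=1-\frac{\sqrt{14}}4\approx 0.0646$ be the smallest solution of $\frac{4u_0}{\psi(2u_0)}=\frac12$. Theorem 5 (Approximate zero Theorem). Let $f\in\mathbb P(\mathcal H_{(d)})$ and $\zeta,x\in\mathbb P(\mathbb C^{n+1})$ with $f(\zeta)=0$. If $$d(x,\zeta)<\frac{u_0}{D^{3/2}\,\mu_{\rm norm}(f,\zeta)}$$ (the right-hand side being $0$ if $\mu_{\rm norm}(f,\zeta)=\infty$), then for every integer $k\ge 0$ the iterate $N_f^k(x)$ is defined and $$d(N_f^k(x),\zeta)\le \frac{1}{2^{2^k-1}}\,d(x,\zeta).$$ -/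

import Mathlib

open scoped LinearAlgebra.Projectivization ENNReal

namespace ProjNewton

/-- The Hermitian space `ℂᵐ`. -/
abbrev E (m : ℕ) := EuclideanSpace ℂ (Fin m)

/-- The space of systems `f = (f₁, …, fₙ)` where `fᵢ ∈ ℂ[X₀, …, Xₙ]` is homogeneous of
degree `dᵢ`. -/
abbrev PolySystem {n : ℕ} (d : Fin n → ℕ) :=
  (i : Fin n) → MvPolynomial.homogeneousSubmodule (Fin (n + 1)) ℂ (d i)

/-- The maximum `D` of the degrees. -/
def maxDegree {n : ℕ} (d : Fin n → ℕ) : ℕ := Finset.univ.sup d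

section Vectors

variable {n : ℕ} {d : Fin n → ℕ}

/-- `f` as a map `ℂⁿ⁺¹ → ℂⁿ`. -/
noncomputable def evalSystem (f : PolySystem d) (x : E (n + 1)) : E n :=
  WithLp.toLp 2 fun i => MvPolynomial.eval (fun j => x j) (f i).1

/-- The derivative `Df(x) : ℂⁿ⁺¹ → ℂⁿ`, given by the Jacobian matrix. -/
noncomputable def jacobian (f : PolySystem d) (x : E (n + 1)) : E (n + 1) →L[ℂ] E n :=
  (Matrix.toEuclideanLin (Matrix.of fun i j =>
    MvPolynomial.eval (fun k => x k) (MvPolynomial.pderiv j (f i).1))).toContinuousLinearMap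

/-- The restriction `Df(x)|_{x^⊥}` to the Hermitian complement of `x`. -/
noncomputable def jacobianPerp (f : PolySystem d) (x : E (n + 1)) :
    (Submodule.span ℂ {x})ᗮ →L[ℂ] E n :=
  jacobian f x ∘L (Submodule.span ℂ {x})ᗮ.subtypeL

/-- The Bombieri–Weyl (Kostlan) norm: `‖f‖² = ∑ᵢ ∑_α |fᵢ,α|² / (dᵢ choose α)`. -/
noncomputable def weylNorm (f : PolySystem d) : ℝ :=
  √(∑ i, ∑ α ∈ (f i).1.support,
    ‖MvPolynomial.coeff α (f i).1‖ ^ 2 / (Finsupp.multinomial α : ℝ))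

/-- The diagonal operator `Δ(a₁, …, aₙ)` on `ℂⁿ`. -/
noncomputable def diagOp (a : Fin n → ℂ) : E n →L[ℂ] E n :=
  Matrix.toEuclideanCLM (𝕜 := ℂ) (Matrix.diagonal a)

open Classical in
/-- The normalized condition number
`‖f‖ ‖(Df(x)|_{x^⊥})⁻¹ Δ(dᵢ^{1/2} ‖x‖^{dᵢ-1})‖` (operator norm) for representatives `f`, `x`;
it is `∞` where the inverse does not exist. -/
noncomputable def muNormVec (f : PolySystem d) (x : E (n + 1)) : ℝ≥0∞ :=
  if (jacobianPerp f x).IsInvertible then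
    ENNReal.ofReal (weylNorm f * ‖(jacobianPerp f x).inverse ∘L
      diagOp fun i => ((√(d i) * ‖x‖ ^ (d i - 1) : ℝ) : ℂ)‖)
  else ∞

/-- The vector `x - (Df(x)|_{x^⊥})⁻¹ f(x)` (meaningful where the inverse exists). -/
noncomputable def newtonVec (f : PolySystem d) (x : E (n + 1)) : E (n + 1) :=
  x - ((jacobianPerp f x).inverse (evalSystem f x) : E (n + 1))

theorem newtonVec_ne_zero (f : PolySystem d) {x : E (n + 1)} (hx : x ≠ 0) :
    newtonVec f x ≠ 0 := by
  intro h
  have hv := ((jacobianPerp f x).inverse (evalSystem f x)).2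
  have h' : x = ((jacobianPerp f x).inverse (evalSystem f x) : E (n + 1)) := sub_eq_zero.mp h
  rw [← h', Submodule.mem_orthogonal_singleton_iff_inner_right] at hv
  exact hx (inner_self_eq_zero.mp hv)

/-- The angle between the complex lines through `x` and `y`. -/
noncomputable def lineAngle (x y : E (n + 1)) : ℝ :=
  Real.arccos (‖inner ℂ x y‖ / (‖x‖ * ‖y‖))

end Vectors

section Projective

variable {n : ℕ} {d : Fin n → ℕ}

/-- `f(x) = 0` for points `f`, `x` of the projective spaces. -/
def IsZero (f : ℙ ℂ (PolySystem d)) (x : ℙ ℂ (E (n + 1))) : Prop :=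
  evalSystem f.rep x.rep = 0

/-- The Riemannian distance of the projective space, i.e. the angle. -/
noncomputable def projDist (x y : ℙ ℂ (E (n + 1))) : ℝ := lineAngle x.rep y.rep

/-- The normalized condition number on the product of the projective spaces. -/
noncomputable def muNorm (f : ℙ ℂ (PolySystem d)) (x : ℙ ℂ (E (n + 1))) : ℝ≥0∞ :=
  muNormVec f.rep x.rep

/-- The projective Newton iteration `N_f`, a partial map of the projective space to itself,
defined where `Df(x)|_{x^⊥}` is invertible. -/
noncomputable def newton (f : ℙ ℂ (PolySystem d)) : ℙ ℂ (E (n + 1)) →. ℙ ℂ (E (n + 1)) :=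
  fun x => ⟨(jacobianPerp f.rep x.rep).IsInvertible,
    fun _ => Projectivization.mk ℂ (newtonVec f.rep x.rep) (newtonVec_ne_zero _ x.rep_nonzero)⟩

/-- The iterates `N_f^k`; `N_f^k(x)` is defined iff all `k` successive steps are. -/
noncomputable def newtonIter (f : ℙ ℂ (PolySystem d)) :
    ℕ → (ℙ ℂ (E (n + 1)) →. ℙ ℂ (E (n + 1)))
  | 0 => fun x => Part.some x
  | k + 1 => fun x => (newtonIter f k x).bind (newton f)

end Projective

/-! The quantities above do not depend on the representatives. -/

section Invariance

variable {n : ℕ} {d : Fin n → ℕ}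

theorem eval_smul_of_isHomogeneous {m l : ℕ} {p : MvPolynomial (Fin m) ℂ}
    (hp : p.IsHomogeneous l) (t : ℂ) (x : Fin m → ℂ) :
    MvPolynomial.eval (fun j => t * x j) p = t ^ l * MvPolynomial.eval x p := by
  rw [MvPolynomial.eval_eq, MvPolynomial.eval_eq, Finset.mul_sum]
  refine Finset.sum_congr rfl fun α hα => ?_
  have h : α.degree = l := by
    have := hp (MvPolynomial.mem_support_iff.mp hα)
    rw [← this, Finsupp.degree_eq_weight_one]
    rfl
  simp only [mul_pow, Finset.prod_mul_distrib]
  rw [Finset.prod_pow_eq_pow_sum, show ∑ i ∈ α.support, α i = l from h]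
  ring

theorem diagOp_apply (a : Fin n → ℂ) (v : E n) (i : Fin n) : diagOp a v i = a i * v i := by
  simp [diagOp, Matrix.mulVec_diagonal]

theorem diagOp_comp (a b : Fin n → ℂ) : diagOp a ∘L diagOp b = diagOp (fun i => a i * b i) := by
  ext v i
  simp [diagOp_apply, mul_assoc]

theorem diagOp_one : diagOp (fun _ : Fin n => (1 : ℂ)) = ContinuousLinearMap.id ℂ (E n) := by
  ext v i
  simp [diagOp_apply]

/-- The diagonal operator with nonzero entries, as an equivalence. -/
noncomputable def diagEquiv (a : Fin n → ℂ) (ha : ∀ i, a i ≠ 0) : E n ≃L[ℂ] E n :=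
  ContinuousLinearEquiv.equivOfInverse (diagOp a) (diagOp fun i => (a i)⁻¹)
    (fun v => by ext i; simp [diagOp_apply, ha i])
    (fun v => by ext i; simp [diagOp_apply, ha i])

theorem norm_comp_diagOp_le {F : Type*} [NormedAddCommGroup F] [NormedSpace ℂ F]
    (B : E n →L[ℂ] F) {a b : Fin n → ℂ} (h : ∀ i, ‖a i‖ ≤ ‖b i‖) :
    ‖B ∘L diagOp a‖ ≤ ‖B ∘L diagOp b‖ := by
  have hab : diagOp a = diagOp b ∘L diagOp (fun i => a i / b i) := by
    rw [diagOp_comp]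
    congr 1
    ext i
    rcases eq_or_ne (b i) 0 with h0 | h0
    · have := h i
      rw [h0, norm_zero, norm_le_zero_iff] at this
      simp [this]
    · field_simp
  have h1 : ‖diagOp (fun i => a i / b i)‖ ≤ 1 := by
    refine ContinuousLinearMap.opNorm_le_bound _ zero_le_one fun v => ?_
    rw [one_mul, EuclideanSpace.norm_eq, EuclideanSpace.norm_eq]
    refine Real.sqrt_le_sqrt (Finset.sum_le_sum fun i _ => ?_)
    rw [diagOp_apply, norm_mul, norm_div]
    have : ‖a i‖ / ‖b i‖ ≤ 1 := div_le_one_of_le₀ (h i) (norm_nonneg _)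
    gcongr
    exact mul_le_of_le_one_left (norm_nonneg _) this
  rw [hab, ← ContinuousLinearMap.comp_assoc]
  exact (ContinuousLinearMap.opNorm_comp_le _ _).trans
    (mul_le_of_le_one_right (norm_nonneg _) h1)

theorem evalSystem_smul (f : PolySystem d) (x : E (n + 1)) (c t : ℂ) :
    evalSystem (c • f) (t • x) = diagOp (fun i => c * t ^ d i) (evalSystem f x) := by
  ext i
  have := eval_smul_of_isHomogeneous
    ((MvPolynomial.mem_homogeneousSubmodule _ _).mp (f i).2) t (fun j => x j)
  simp only [diagOp_apply, evalSystem]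
  simp [this, mul_assoc]

theorem jacobian_smul (f : PolySystem d) (x : E (n + 1)) (c t : ℂ) :
    jacobian (c • f) (t • x) = diagOp (fun i => c * t ^ (d i - 1)) ∘L jacobian f x := by
  ext v i
  have h (j : Fin (n + 1)) := eval_smul_of_isHomogeneous
    (((MvPolynomial.mem_homogeneousSubmodule _ _).mp (f i).2).pderiv (i := j)) t (fun j => x j)
  rw [ContinuousLinearMap.comp_apply, diagOp_apply]
  simp [jacobian, Matrix.mulVec, dotProduct, h, Finset.mul_sum, mul_assoc]

theorem weylNorm_smul (f : PolySystem d) (c : ℂ) : weylNorm (c • f) = ‖c‖ * weylNorm f := by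
  rcases eq_or_ne c 0 with rfl | hc
  · simp [weylNorm]
  · have hs (i : Fin n) : ((c • f) i).1.support = (f i).1.support :=
      MvPolynomial.support_smul_eq (h := hc) _
    rw [weylNorm, weylNorm]
    rw [← Real.sqrt_sq (norm_nonneg c)]
    rw [← Real.sqrt_mul (sq_nonneg _), Finset.mul_sum]
    congr 1
    refine Finset.sum_congr rfl fun i _ => ?_
    rw [hs, Finset.mul_sum]
    refine Finset.sum_congr rfl fun α _ => ?_
    simp [mul_pow, mul_div_assoc]

theorem span_smul_eq {t : ℂ} (ht : t ≠ 0) (x : E (n + 1)) :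
    Submodule.span ℂ {t • x} = Submodule.span ℂ {x} :=
  Submodule.span_singleton_smul_eq ht.isUnit x

theorem muNormVec_smul (f : PolySystem d) (x : E (n + 1)) {c t : ℂ} (hc : c ≠ 0) (ht : t ≠ 0) :
    muNormVec (c • f) (t • x) = muNormVec f x := by
  have hT : ∀ i, c * t ^ (d i - 1) ≠ 0 := fun i => mul_ne_zero hc (pow_ne_zero _ ht)
  unfold muNormVec jacobianPerp
  rw [span_smul_eq ht, jacobian_smul, ContinuousLinearMap.comp_assoc,
    show diagOp (fun i => c * t ^ (d i - 1)) = (diagEquiv _ hT : E n →L[ℂ] E n) from rfl,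
    ContinuousLinearMap.isInvertible_equiv_comp, ContinuousLinearMap.inverse_equiv_comp]
  split_ifs with h
  · congr 1
    set B := (jacobian f x ∘L (Submodule.span ℂ {x})ᗮ.subtypeL).inverse
    rw [ContinuousLinearMap.comp_assoc,
      show ((diagEquiv _ hT).symm : E n →L[ℂ] E n) =
        diagOp (fun i => (c * t ^ (d i - 1))⁻¹) from rfl, diagOp_comp, weylNorm_smul]
    have hcn : (‖c‖ : ℂ) ≠ 0 := by simpa using hc
    have hn (i : Fin n) :
        ‖(c * t ^ (d i - 1))⁻¹ * ((√(d i) * ‖t • x‖ ^ (d i - 1) : ℝ) : ℂ)‖ =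
          ‖(‖c‖ : ℂ)⁻¹ * ((√(d i) * ‖x‖ ^ (d i - 1) : ℝ) : ℂ)‖ := by
      have h1 : ‖c‖ ≠ 0 := by simpa using hc
      have h2 : ‖t‖ ≠ 0 := by simpa using ht
      simp only [norm_mul, norm_inv, norm_pow, norm_smul, Complex.norm_real, norm_norm]
      field_simp
      rw [mul_pow]
      ring
    have hB := le_antisymm (norm_comp_diagOp_le B fun i => (hn i).le)
      (norm_comp_diagOp_le B fun i => (hn i).ge)
    rw [hB]
    have hsm : diagOp (fun i => (‖c‖ : ℂ)⁻¹ * ((√(d i) * ‖x‖ ^ (d i - 1) : ℝ) : ℂ)) =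
        (‖c‖ : ℂ)⁻¹ • diagOp (fun i => ((√(d i) * ‖x‖ ^ (d i - 1) : ℝ) : ℂ)) := by
      ext v i
      simp [diagOp_apply, mul_assoc]
    rw [hsm, ContinuousLinearMap.comp_smul, norm_smul, norm_inv, Complex.norm_real, norm_norm]
    have h1 : ‖c‖ ≠ 0 := by simpa using hc
    field_simp
  · rfl

theorem jacobianPerp_smul_isInvertible (f : PolySystem d) (x : E (n + 1)) {c t : ℂ}
    (hc : c ≠ 0) (ht : t ≠ 0) :
    (jacobianPerp (c • f) (t • x)).IsInvertible ↔ (jacobianPerp f x).IsInvertible := by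
  have hT : ∀ i, c * t ^ (d i - 1) ≠ 0 := fun i => mul_ne_zero hc (pow_ne_zero _ ht)
  unfold jacobianPerp
  rw [span_smul_eq ht, jacobian_smul, ContinuousLinearMap.comp_assoc,
    show diagOp (fun i => c * t ^ (d i - 1)) = (diagEquiv _ hT : E n →L[ℂ] E n) from rfl,
    ContinuousLinearMap.isInvertible_equiv_comp]

theorem newtonVec_smul (hd : ∀ i, 0 < d i) (f : PolySystem d) (x : E (n + 1)) {c t : ℂ}
    (hc : c ≠ 0) (ht : t ≠ 0) : newtonVec (c • f) (t • x) = t • newtonVec f x := by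
  have hT : ∀ i, c * t ^ (d i - 1) ≠ 0 := fun i => mul_ne_zero hc (pow_ne_zero _ ht)
  unfold newtonVec jacobianPerp
  rw [span_smul_eq ht, jacobian_smul, ContinuousLinearMap.comp_assoc, evalSystem_smul,
    show diagOp (fun i => c * t ^ (d i - 1)) = (diagEquiv _ hT : E n →L[ℂ] E n) from rfl,
    ContinuousLinearMap.inverse_equiv_comp, ContinuousLinearMap.comp_apply]
  have : ((diagEquiv _ hT).symm : E n →L[ℂ] E n)
      (diagOp (fun i => c * t ^ d i) (evalSystem f x)) = t • evalSystem f x := by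
    rw [show ((diagEquiv _ hT).symm : E n →L[ℂ] E n) =
        diagOp (fun i => (c * t ^ (d i - 1))⁻¹) from rfl]
    ext i
    obtain ⟨e, he⟩ := Nat.exists_eq_succ_of_ne_zero (hd i).ne'
    simp only [diagOp_apply, PiLp.smul_apply, smul_eq_mul, he, Nat.succ_eq_add_one,
      Nat.add_sub_cancel, pow_succ]
    field_simp
  rw [this, map_smul, smul_sub, Submodule.coe_smul]

theorem lineAngle_smul (x y : E (n + 1)) {s t : ℂ} (hs : s ≠ 0) (ht : t ≠ 0) :
    lineAngle (s • x) (t • y) = lineAngle x y := by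
  have h1 : ‖s‖ ≠ 0 := by simpa using hs
  have h2 : ‖t‖ ≠ 0 := by simpa using ht
  unfold lineAngle
  congr 1
  rw [inner_smul_left, inner_smul_right, norm_mul, norm_mul, norm_smul, norm_smul,
    RCLike.norm_conj,
    show ‖s‖ * (‖t‖ * ‖inner ℂ x y‖) = (‖s‖ * ‖t‖) * ‖inner ℂ x y‖ by ring,
    show ‖s‖ * ‖x‖ * (‖t‖ * ‖y‖) = (‖s‖ * ‖t‖) * (‖x‖ * ‖y‖) by ring,
    mul_div_mul_left _ _ (mul_ne_zero h1 h2)]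

theorem exists_rep_eq {V : Type*} [AddCommGroup V] [Module ℂ V] {v : V} (hv : v ≠ 0) :
    ∃ c : ℂ, c ≠ 0 ∧ (Projectivization.mk ℂ v hv).rep = c • v := by
  obtain ⟨a, ha⟩ := Projectivization.exists_smul_eq_mk_rep ℂ v hv
  exact ⟨a, a.ne_zero, ha.symm⟩

theorem isZero_mk {f : PolySystem d} {x : E (n + 1)} (hf : f ≠ 0) (hx : x ≠ 0) :
    IsZero (Projectivization.mk ℂ f hf) (Projectivization.mk ℂ x hx) ↔ evalSystem f x = 0 := by
  obtain ⟨c, hc, hc'⟩ := exists_rep_eq hf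
  obtain ⟨t, ht, ht'⟩ := exists_rep_eq hx
  rw [IsZero, hc', ht', evalSystem_smul,
    show diagOp (fun i => c * t ^ d i) = (diagEquiv _
      (fun i => mul_ne_zero hc (pow_ne_zero (d i) ht)) : E n →L[ℂ] E n) from rfl]
  exact ContinuousLinearEquiv.map_eq_zero_iff _

theorem projDist_mk {x y : E (n + 1)} (hx : x ≠ 0) (hy : y ≠ 0) :
    projDist (Projectivization.mk ℂ x hx) (Projectivization.mk ℂ y hy) = lineAngle x y := by
  obtain ⟨s, hs, hs'⟩ := exists_rep_eq hx
  obtain ⟨t, ht, ht'⟩ := exists_rep_eq hy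
  rw [projDist, hs', ht', lineAngle_smul x y hs ht]

theorem muNorm_mk {f : PolySystem d} {x : E (n + 1)} (hf : f ≠ 0) (hx : x ≠ 0) :
    muNorm (Projectivization.mk ℂ f hf) (Projectivization.mk ℂ x hx) = muNormVec f x := by
  obtain ⟨c, hc, hc'⟩ := exists_rep_eq hf
  obtain ⟨t, ht, ht'⟩ := exists_rep_eq hx
  rw [muNorm, hc', ht', muNormVec_smul f x hc ht]

theorem mem_newton_mk (hd : ∀ i, 0 < d i) {f : PolySystem d} {x : E (n + 1)}
    (hf : f ≠ 0) (hx : x ≠ 0) (y : ℙ ℂ (E (n + 1))) :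
    y ∈ newton (Projectivization.mk ℂ f hf) (Projectivization.mk ℂ x hx) ↔
      (jacobianPerp f x).IsInvertible ∧
        y = Projectivization.mk ℂ (newtonVec f x) (newtonVec_ne_zero f hx) := by
  obtain ⟨c, hc, hc'⟩ := exists_rep_eq hf
  obtain ⟨t, ht, ht'⟩ := exists_rep_eq hx
  have h : Projectivization.mk ℂ (newtonVec (Projectivization.mk ℂ f hf).rep
      (Projectivization.mk ℂ x hx).rep) (newtonVec_ne_zero _ (Projectivization.rep_nonzero _)) =
      Projectivization.mk ℂ (newtonVec f x) (newtonVec_ne_zero f hx) := by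
    rw [Projectivization.mk_eq_mk_iff']
    exact ⟨t, by rw [hc', ht', newtonVec_smul hd f x hc ht]⟩
  rw [newton, Part.mem_mk_iff, h, hc', ht', jacobianPerp_smul_isInvertible f x hc ht,
    exists_prop]
  exact and_congr_right fun _ => eq_comm

end Invariance

/-- The quadratic polynomial `ψ(u) = 1 - 4u + 2u²`. -/
noncomputable def psi (u : ℝ) : ℝ := 1 - 4 * u + 2 * u ^ 2

/-- The constant `u₀ = (16 - √224)/16 = 1 - √14/4 ≈ 0.0646`. -/
noncomputable def u0 : ℝ := (16 - √224) / 16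

/-- `u₀` is the smallest solution of `4u/ψ(2u) = 1/2`. -/
theorem isLeast_u0 : IsLeast {u : ℝ | 4 * u / psi (2 * u) = 1 / 2} u0 := by
  have hs : √224 ^ 2 = 224 := Real.sq_sqrt (by norm_num)
  have hs0 : 0 ≤ √224 := Real.sqrt_nonneg _
  have hlt : √224 < 15 := by nlinarith
  constructor
  · have h8 : psi (2 * u0) = 8 * u0 := by
      unfold psi u0
      linarith
    have hu : 0 < u0 := by
      unfold u0
      linarith
    simp only [Set.mem_ofPred_eq]
    rw [h8]
    field_simp
    norm_num
  · intro u hu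
    simp only [Set.mem_ofPred_eq] at hu
    have hp : psi (2 * u) ≠ 0 := by
      intro h
      rw [h, div_zero] at hu
      norm_num at hu
    rw [div_eq_iff hp] at hu
    unfold psi at hu
    unfold u0
    by_contra! h
    nlinarith

end ProjNewton

/-! Everything happens in the affine chart `x + x^⊥`. Normalise `‖x‖ = 1` and represent the zero by
`z = x + w` with `w ⊥ x`; if δ is the angle, then `‖w‖ = tan δ` and `‖z‖ = 1 / cos δ`. The Newton
point `y` lies in the same chart, and `Df(x)` sends `y - z` to the Taylor remainder `f(z) - f(x) -
Df(x)w`. So two estimates suffice.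

Upper bound: the Bombieri–Weyl norm controls evaluation (`norm_eval_le`) and differentiation
(`polyWeyl_dirDeriv_le`). After division by the weights `dᵢ^{1/2} ‖z‖^{dᵢ-1}`, the remainder is at
most `D^{3/2} ‖f‖ ‖w‖²` (`norm_unscale_taylor_le`); second derivatives are enough.

Lower bound: at the zero, Euler's identity gives `Df(z)z = 0`, so replacing `z^⊥` by `x^⊥` costs
only the factor `‖z‖⁻¹`. Replacing `Df(z)` by `Df(x)` costs `M ‖w‖`, where `M = D^{3/2} μ`
(`sub_mul_norm_le`).

Together, `‖y - z‖ ≤ M ‖w‖² / (‖z‖⁻¹ - M ‖w‖)`. Since `M ≥ 1` (`one_le_scaledCond`), the hypothesis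
`M δ < u₀` makes both δ and `M ‖w‖` small, and the new angle is at most `M δ² / (2 u₀)`. Iterating
this quadratic bound gives the exponents `2^k - 1`. -/

namespace ProjNewton

/-! ### Bombieri–Weyl estimates for one homogeneous polynomial. -/

section PolynomialBounds

variable {m : ℕ}

/-- The Bombieri–Weyl norm of a single polynomial. -/
noncomputable def polyWeyl (p : MvPolynomial (Fin m) ℂ) : ℝ :=
  √(∑ α ∈ p.support, ‖MvPolynomial.coeff α p‖ ^ 2 / (Finsupp.multinomial α : ℝ))

theorem polyWeyl_nonneg (p : MvPolynomial (Fin m) ℂ) : 0 ≤ polyWeyl p := Real.sqrt_nonneg _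

theorem polyWeyl_sq (p : MvPolynomial (Fin m) ℂ) :
    polyWeyl p ^ 2 =
      ∑ α ∈ p.support, ‖MvPolynomial.coeff α p‖ ^ 2 / (Finsupp.multinomial α : ℝ) :=
  Real.sq_sqrt (Finset.sum_nonneg fun _ _ => by positivity)

theorem sum_eq_of_mem_support {p : MvPolynomial (Fin m) ℂ} {l : ℕ} (hp : p.IsHomogeneous l)
    {α : Fin m →₀ ℕ} (hα : MvPolynomial.coeff α p ≠ 0) : ∑ j, α j = l := by
  have h : α.degree = l := by
    have := hp hα
    rw [← this, Finsupp.degree_eq_weight_one]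
    rfl
  rw [← h, Finsupp.degree_eq_sum]

theorem multinomial_eq_univ (α : Fin m →₀ ℕ) :
    Finsupp.multinomial α = Nat.multinomial Finset.univ α :=
  Finsupp.multinomial_eq_of_support_subset (Finset.subset_univ _)

theorem multinomial_cast_pos (α : Fin m →₀ ℕ) : (0 : ℝ) < (Finsupp.multinomial α : ℝ) := by
  rw [multinomial_eq_univ]
  exact_mod_cast Nat.multinomial_pos _ _

/-- The left side is part of the multinomial expansion of the right side, whose terms are all
nonnegative. -/
theorem sum_multinomial_mul_prod_le {S : Finset (Fin m →₀ ℕ)} {l : ℕ}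
    (hS : ∀ α ∈ S, ∑ j, α j = l) {y : Fin m → ℝ} (hy : ∀ j, 0 ≤ y j) :
    ∑ α ∈ S, (Finsupp.multinomial α : ℝ) * ∏ j, y j ^ α j ≤ (∑ j, y j) ^ l := by
  classical
  rw [Finset.sum_pow_eq_sum_piAntidiag]
  have h := Finset.sum_image (s := S) (g := fun α : Fin m →₀ ℕ => (α : Fin m → ℕ))
    (f := fun k : Fin m → ℕ => (Nat.multinomial Finset.univ k : ℝ) * ∏ j, y j ^ k j)
    (DFunLike.coe_injective.injOn)
  simp only [multinomial_eq_univ]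
  rw [← h]
  refine Finset.sum_le_sum_of_subset_of_nonneg ?_ fun k _ _ =>
    mul_nonneg (Nat.cast_nonneg _) (Finset.prod_nonneg fun j _ => pow_nonneg (hy j) _)
  intro k hk
  obtain ⟨α, hα, rfl⟩ := Finset.mem_image.mp hk
  simp [Finset.mem_piAntidiag, hS α hα]

/-- Evaluation is bounded by the Bombieri–Weyl norm. -/
theorem norm_eval_le {p : MvPolynomial (Fin m) ℂ} {l : ℕ} (hp : p.IsHomogeneous l) (x : E m) :
    ‖MvPolynomial.eval (fun j => x j) p‖ ≤ polyWeyl p * ‖x‖ ^ l := by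
  rw [MvPolynomial.eval_eq']
  -- Splitting each monomial by the square root of its multinomial coefficient prepares
  -- Cauchy–Schwarz: one factor sums to the Weyl norm, the other to the multinomial theorem.
  have h1 : ‖∑ α ∈ p.support, MvPolynomial.coeff α p * ∏ j, x j ^ α j‖ ≤
      ∑ α ∈ p.support, √(‖MvPolynomial.coeff α p‖ ^ 2 / (Finsupp.multinomial α : ℝ)) *
        √((Finsupp.multinomial α : ℝ) * ∏ j, (‖x j‖ ^ 2) ^ α j) := by
    refine (norm_sum_le _ _).trans (Finset.sum_le_sum fun α _ => le_of_eq ?_)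
    have hm := multinomial_cast_pos α
    rw [← Real.sqrt_mul (by positivity)]
    have : ‖MvPolynomial.coeff α p‖ ^ 2 / (Finsupp.multinomial α : ℝ) *
        ((Finsupp.multinomial α : ℝ) * ∏ j, (‖x j‖ ^ 2) ^ α j) =
        ‖MvPolynomial.coeff α p * ∏ j, x j ^ α j‖ ^ 2 := by
      rw [norm_mul, norm_prod, mul_pow, ← Finset.prod_pow]
      field_simp
      congr 1
      refine Finset.prod_congr rfl fun j _ => ?_
      rw [norm_pow]
      ring
    rw [this, Real.sqrt_sq (norm_nonneg _)]
  refine h1.trans ((Real.sum_sqrt_mul_sqrt_le _ (fun α => by positivity)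
    (fun α => by positivity)).trans ?_)
  rw [polyWeyl]
  gcongr
  rw [Real.sqrt_le_left (by positivity), ← pow_mul, mul_comm l 2, pow_mul,
    EuclideanSpace.norm_sq_eq]
  exact sum_multinomial_mul_prod_le
    (fun α hα => sum_eq_of_mem_support hp (MvPolynomial.mem_support_iff.mp hα))
    fun j => by positivity

/-- The directional derivative `∑ⱼ vⱼ ∂p/∂Xⱼ`. -/
noncomputable def dirDeriv (v : E m) (p : MvPolynomial (Fin m) ℂ) : MvPolynomial (Fin m) ℂ :=
  ∑ j, v j • MvPolynomial.pderiv j p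

theorem dirDeriv_isHomogeneous (v : E m) {p : MvPolynomial (Fin m) ℂ} {l : ℕ}
    (hp : p.IsHomogeneous l) : (dirDeriv v p).IsHomogeneous (l - 1) :=
  MvPolynomial.IsHomogeneous.sum _ _ _ fun j _ => by
    rw [MvPolynomial.smul_eq_C_mul]
    simpa using (MvPolynomial.isHomogeneous_C (Fin m) (v j)).mul (hp.pderiv (i := j))

theorem coeff_dirDeriv (v : E m) (p : MvPolynomial (Fin m) ℂ) (β : Fin m →₀ ℕ) :
    MvPolynomial.coeff β (dirDeriv v p) =
      ∑ j, v j * (MvPolynomial.coeff (β + Finsupp.single j 1) p * (β j + 1)) := by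
  simp [dirDeriv, MvPolynomial.coeff_sum, MvPolynomial.coeff_smul, MvPolynomial.coeff_pderiv]

/-- This compares the Weyl weights of a polynomial and of its partial derivatives; it follows from
the factorial formula for both multinomials. -/
theorem multinomial_add_single (β : Fin m →₀ ℕ) (j : Fin m) :
    (Finsupp.multinomial (β + Finsupp.single j 1) : ℝ) * (β j + 1) =
      (∑ i, β i + 1 : ℕ) * Finsupp.multinomial β := by
  have h1 := Nat.multinomial_spec Finset.univ β
  have h2 := Nat.multinomial_spec Finset.univ (β + Finsupp.single j 1 : Fin m →₀ ℕ)
  have hs : ∑ i, (β + Finsupp.single j 1 : Fin m →₀ ℕ) i = ∑ i, β i + 1 := by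
    simp [Finset.sum_add_distrib, Finsupp.single_apply]
  have hp : ∏ i, ((β + Finsupp.single j 1 : Fin m →₀ ℕ) i).factorial =
      (β j + 1) * ∏ i, (β i).factorial := by
    rw [← Finset.mul_prod_erase _ _ (Finset.mem_univ j),
      ← Finset.mul_prod_erase Finset.univ (fun i => (β i).factorial) (Finset.mem_univ j)]
    have : ∏ i ∈ Finset.univ.erase j, ((β + Finsupp.single j 1 : Fin m →₀ ℕ) i).factorial =
        ∏ i ∈ Finset.univ.erase j, (β i).factorial :=
      Finset.prod_congr rfl fun i hi => by
        have : j ≠ i := (Finset.ne_of_mem_erase hi).symm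
        simp [this]
    rw [this]
    simp [Nat.factorial_succ, mul_assoc]
  rw [hs, hp, Nat.factorial_succ, ← h1] at h2
  have hpos : 0 < ∏ i, (β i).factorial := Finset.prod_pos fun i _ => Nat.factorial_pos _
  have h3 : Nat.multinomial Finset.univ (β + Finsupp.single j 1 : Fin m →₀ ℕ) * (β j + 1) =
      (∑ i, β i + 1) * Nat.multinomial Finset.univ β := by
    apply Nat.eq_of_mul_eq_mul_left hpos
    linarith
  rw [multinomial_eq_univ, multinomial_eq_univ]
  exact_mod_cast h3

/-- Differentiation is bounded for the Bombieri–Weyl norm. -/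
theorem polyWeyl_dirDeriv_le (v : E m) {p : MvPolynomial (Fin m) ℂ} {l : ℕ}
    (hp : p.IsHomogeneous l) : polyWeyl (dirDeriv v p) ≤ l * ‖v‖ * polyWeyl p := by
  classical
  have hl (β : Fin m →₀ ℕ) (j : Fin m)
      (h : MvPolynomial.coeff (β + Finsupp.single j 1) p ≠ 0) : ∑ i, β i + 1 = l := by
    rw [← sum_eq_of_mem_support hp h]
    simp [Finset.sum_add_distrib, Finsupp.single_apply]
  -- The factor `α j` is what remains of the square `(β j + 1) ^ 2` once `multinomial_add_single`
  -- has traded one power for `l`. Summing over `j` yields the second factor `l`.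
  set g : Fin m → (Fin m →₀ ℕ) → ℝ := fun j α =>
    α j * (‖MvPolynomial.coeff α p‖ ^ 2 / (Finsupp.multinomial α : ℝ)) with hg
  have hg0 (j α) : 0 ≤ g j α := by positivity
  have hterm (β : Fin m →₀ ℕ) :
      ‖MvPolynomial.coeff β (dirDeriv v p)‖ ^ 2 / (Finsupp.multinomial β : ℝ) ≤
        ‖v‖ ^ 2 * (l * ∑ j, g j (β + Finsupp.single j 1)) := by
    have hb := multinomial_cast_pos β
    have hcs : ‖MvPolynomial.coeff β (dirDeriv v p)‖ ^ 2 ≤ ‖v‖ ^ 2 *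
        ∑ j, ‖MvPolynomial.coeff (β + Finsupp.single j 1) p * (β j + 1)‖ ^ 2 := by
      rw [coeff_dirDeriv, EuclideanSpace.norm_sq_eq]
      refine le_trans ?_ (Finset.sum_mul_sq_le_sq_mul_sq _ _ _)
      gcongr
      refine (norm_sum_le _ _).trans (le_of_eq ?_)
      simp only [norm_mul]
    rw [div_le_iff₀ hb]
    refine hcs.trans ?_
    rw [mul_assoc, mul_assoc, Finset.sum_mul, Finset.mul_sum (s := Finset.univ) (a := (l : ℝ))]
    gcongr with j
    -- Homogeneity identifies `∑ i, β i + 1` with `l` only where the coefficient is nonzero.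
    rcases eq_or_ne (MvPolynomial.coeff (β + Finsupp.single j 1) p) 0 with h0 | h0
    · simp [h0, hg]
    · have hm := multinomial_add_single β j
      rw [hl β j h0] at hm
      have ha := multinomial_cast_pos (β + Finsupp.single j 1)
      have hn : ‖((β j : ℂ) + 1)‖ = (β j : ℝ) + 1 := by
        rw [← Nat.cast_succ, Complex.norm_natCast]
        push_cast
        rfl
      simp only [hg, norm_mul, hn, mul_pow, Finsupp.add_apply, Finsupp.single_eq_same]
      push_cast
      refine le_of_eq ?_
      field_simp
      linarith
  -- The shift of exponents is injective and `g j` vanishes off the support of `p`.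
  have hshift (j : Fin m) (T : Finset (Fin m →₀ ℕ)) :
      ∑ β ∈ T, g j (β + Finsupp.single j 1) ≤ ∑ α ∈ p.support, g j α := by
    rw [← Finset.sum_image (f := g j) (g := fun β => β + Finsupp.single j 1)
      (fun a _ b _ h => add_right_cancel h)]
    refine (Finset.sum_le_sum_of_subset_of_nonneg Finset.subset_union_left
      fun _ _ _ => hg0 _ _).trans (le_of_eq (Finset.sum_subset (s₁ := p.support)
        Finset.subset_union_right fun α _ hα => ?_).symm)
    simp [hg, MvPolynomial.notMem_support_iff.mp hα]
  have hsq : polyWeyl (dirDeriv v p) ^ 2 ≤ (l * ‖v‖ * polyWeyl p) ^ 2 := by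
    rw [polyWeyl_sq, mul_pow, polyWeyl_sq]
    refine (Finset.sum_le_sum fun β _ => hterm β).trans ?_
    rw [← Finset.mul_sum, ← Finset.mul_sum, Finset.sum_comm]
    have : ∑ j, ∑ α ∈ p.support, g j α = l *
        ∑ α ∈ p.support, ‖MvPolynomial.coeff α p‖ ^ 2 / (Finsupp.multinomial α : ℝ) := by
      rw [Finset.sum_comm, Finset.mul_sum]
      refine Finset.sum_congr rfl fun α hα => ?_
      rw [← Finset.sum_mul, ← sum_eq_of_mem_support hp (MvPolynomial.mem_support_iff.mp hα)]
      push_cast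
      rfl
    calc _ ≤ ‖v‖ ^ 2 * (l * ∑ j, ∑ α ∈ p.support, g j α) := by
          gcongr with j
          exact hshift j _
      _ = _ := by rw [this]; ring
  exact (sq_le_sq₀ (polyWeyl_nonneg _) (by have := polyWeyl_nonneg p; positivity)).mp hsq

theorem norm_eval_dirDeriv_le {p : MvPolynomial (Fin m) ℂ} {l : ℕ} (hp : p.IsHomogeneous l)
    (x v : E m) :
    ‖MvPolynomial.eval (fun j => x j) (dirDeriv v p)‖ ≤
      l * ‖v‖ * polyWeyl p * ‖x‖ ^ (l - 1) :=
  (norm_eval_le (dirDeriv_isHomogeneous v hp) x).trans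
    (mul_le_mul_of_nonneg_right (polyWeyl_dirDeriv_le v hp) (by positivity))

theorem norm_eval_dirDeriv_dirDeriv_le {p : MvPolynomial (Fin m) ℂ} {l : ℕ}
    (hp : p.IsHomogeneous l) (x v w : E m) :
    ‖MvPolynomial.eval (fun j => x j) (dirDeriv w (dirDeriv v p))‖ ≤
      (l - 1 : ℕ) * ‖w‖ * (l * ‖v‖ * polyWeyl p) * ‖x‖ ^ (l - 1 - 1) := by
  refine (norm_eval_dirDeriv_le (dirDeriv_isHomogeneous v hp) x w).trans ?_
  gcongr
  exact polyWeyl_dirDeriv_le v hp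

theorem hasDerivAt_eval_line (p : MvPolynomial (Fin m) ℂ) (x w : E m) (s : ℝ) :
    HasDerivAt (fun s : ℝ => MvPolynomial.eval (fun j => (x + s • w) j) p)
      (MvPolynomial.eval (fun j => (x + s • w) j) (dirDeriv w p)) s := by
  induction p using MvPolynomial.induction_on with
  | C a => simpa [dirDeriv] using hasDerivAt_const s a
  | add p q hp hq => 
    have := hp.add hq
    simp only [map_add]
    convert! this using 1
    simp [dirDeriv, Finset.sum_add_distrib]
  | mul_X p i hp =>
    have hx : HasDerivAt (fun s : ℝ => (x + s • w) i) (w i) s := by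
      have := ((hasDerivAt_id s).ofReal_comp.mul_const (w i)).const_add (x i)
      simpa using this
    have := hp.mul hx
    simp only [map_mul, MvPolynomial.eval_X]
    convert! this using 1
    simp [dirDeriv, Finset.sum_add_distrib, mul_add, MvPolynomial.pderiv_X, Pi.single_apply,
      Finset.sum_mul]
    rw [add_comm, mul_comm (w i), ← Finset.sum_add_distrib]
    congr 1
    exact Finset.sum_congr rfl fun j _ => by ring

/-- By Pythagoras the norm grows along the segment, so the endpoint bounds every power of the norm
met by the mean value inequality. -/
theorem norm_add_smul_le {x w : E m} (h : inner ℂ x w = 0) {s : ℝ} (h0 : 0 ≤ s) (h1 : s ≤ 1) :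
    ‖x + s • w‖ ≤ ‖x + w‖ := by
  have e1 := norm_add_sq_eq_norm_sq_add_norm_sq_of_inner_eq_zero x w h
  have e2 := norm_add_sq_eq_norm_sq_add_norm_sq_of_inner_eq_zero x ((s : ℂ) • w)
    (by rw [inner_smul_right, h, mul_zero])
  have hs : ((s : ℂ) • w) = s • w := by ext; simp
  rw [hs, norm_smul, Real.norm_of_nonneg h0] at e2
  refine (sq_le_sq₀ (norm_nonneg _) (norm_nonneg _)).mp ?_
  have := mul_le_of_le_one_left (norm_nonneg w) h1
  nlinarith [norm_nonneg w, mul_nonneg h0 (norm_nonneg w)]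

/-- Variation of the first derivative along a segment orthogonal to its starting point. -/
theorem norm_eval_dirDeriv_sub_le {p : MvPolynomial (Fin m) ℂ} {l : ℕ} (hp : p.IsHomogeneous l)
    {x w : E m} (h : inner ℂ x w = 0) (v : E m) {s : ℝ} (h0 : 0 ≤ s) (h1 : s ≤ 1) :
    ‖MvPolynomial.eval (fun j => (x + s • w) j) (dirDeriv v p) -
        MvPolynomial.eval (fun j => x j) (dirDeriv v p)‖ ≤
      (l - 1 : ℕ) * ‖w‖ * (l * ‖v‖ * polyWeyl p) * ‖x + w‖ ^ (l - 1 - 1) := by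
  have hW := polyWeyl_nonneg p
  have hb : 0 ≤ (l - 1 : ℕ) * ‖w‖ * (l * ‖v‖ * polyWeyl p) * ‖x + w‖ ^ (l - 1 - 1) := by
    positivity
  have key := norm_image_sub_le_of_norm_deriv_le_segment'
    (f := fun s : ℝ => MvPolynomial.eval (fun j => (x + s • w) j) (dirDeriv v p))
    (fun s _ => (hasDerivAt_eval_line (dirDeriv v p) x w s).hasDerivWithinAt)
    (C := (l - 1 : ℕ) * ‖w‖ * (l * ‖v‖ * polyWeyl p) * ‖x + w‖ ^ (l - 1 - 1))
    (a := 0) (b := 1) (fun s hs => by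
      refine (norm_eval_dirDeriv_dirDeriv_le hp _ v w).trans ?_
      have := norm_add_smul_le h hs.1 hs.2.le
      gcongr) s ⟨h0, h1⟩
  simp only [zero_smul, add_zero, sub_zero] at key
  exact key.trans (mul_le_of_le_one_right hb h1)

/-- First order Taylor formula along a segment orthogonal to its starting point. -/
theorem norm_eval_taylor_le {p : MvPolynomial (Fin m) ℂ} {l : ℕ} (hp : p.IsHomogeneous l)
    {x w : E m} (h : inner ℂ x w = 0) :
    ‖MvPolynomial.eval (fun j => (x + w) j) p - MvPolynomial.eval (fun j => x j) p -
        MvPolynomial.eval (fun j => x j) (dirDeriv w p)‖ ≤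
      (l - 1 : ℕ) * ‖w‖ * (l * ‖w‖ * polyWeyl p) * ‖x + w‖ ^ (l - 1 - 1) := by
  -- With the linear part removed, the derivative is the variation of the first derivative. The
  -- factor 1/2 of the sharp remainder is given up here.
  have key := norm_image_sub_le_of_norm_deriv_le_segment_01'
    (f := fun s : ℝ => MvPolynomial.eval (fun j => (x + s • w) j) p -
      (s : ℂ) * MvPolynomial.eval (fun j => x j) (dirDeriv w p))
    (fun s _ => ((hasDerivAt_eval_line p x w s).sub
      ((hasDerivAt_id s).ofReal_comp.mul_const _)).hasDerivWithinAt)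
    (C := (l - 1 : ℕ) * ‖w‖ * (l * ‖w‖ * polyWeyl p) * ‖x + w‖ ^ (l - 1 - 1))
    (fun s hs => by
      simpa using norm_eval_dirDeriv_sub_le hp h w hs.1 hs.2.le)
  simp only [zero_smul, add_zero, one_smul, Complex.ofReal_zero, Complex.ofReal_one, zero_mul,
    sub_zero, one_mul] at key
  rwa [sub_right_comm] at key

end PolynomialBounds

/-! ### Weighted derivative estimates and the condition number. -/

section NewtonStep

variable {n : ℕ} {d : Fin n → ℕ}

theorem weylNorm_eq (f : PolySystem d) : weylNorm f = √(∑ i, polyWeyl (f i).1 ^ 2) := by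
  simp only [weylNorm, polyWeyl_sq]

theorem weylNorm_nonneg (f : PolySystem d) : 0 ≤ weylNorm f := Real.sqrt_nonneg _

theorem system_isHomogeneous (f : PolySystem d) (i : Fin n) : (f i).1.IsHomogeneous (d i) :=
  (MvPolynomial.mem_homogeneousSubmodule _ _).mp (f i).2

theorem jacobian_apply (f : PolySystem d) (x v : E (n + 1)) (i : Fin n) :
    jacobian f x v i = MvPolynomial.eval (fun j => x j) (dirDeriv v (f i).1) := by
  simp [jacobian, dirDeriv, Matrix.mulVec, dotProduct, mul_comm]

/-- Euler's identity at a zero. -/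
theorem jacobian_self_eq_zero (f : PolySystem d) {z : E (n + 1)} (hz : evalSystem f z = 0) :
    jacobian f z z = 0 := by
  ext i
  have h := congrArg (MvPolynomial.eval (fun j => z j))
    (system_isHomogeneous f i).sum_X_mul_pderiv
  have hi : MvPolynomial.eval (fun j => z j) (f i).1 = 0 := congrFun (congrArg WithLp.ofLp hz) i
  rw [jacobian_apply]
  simpa [dirDeriv, hi] using h

/-- The weights `dᵢ^{1/2} ‖z‖^{dᵢ-1}`. -/
noncomputable def weight (d : Fin n → ℕ) (z : E (n + 1)) (i : Fin n) : ℝ :=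
  √(d i) * ‖z‖ ^ (d i - 1)

theorem weight_pos (hd : ∀ i, 0 < d i) {z : E (n + 1)} (hz : z ≠ 0) (i : Fin n) :
    0 < weight d z i :=
  mul_pos (Real.sqrt_pos.mpr (by exact_mod_cast hd i)) (pow_pos (norm_pos_iff.mpr hz) _)

/-- The inverse of the diagonal operator with entries `dᵢ^{1/2} ‖z‖^{dᵢ-1}`. -/
noncomputable def unscale (d : Fin n → ℕ) (z : E (n + 1)) : E n →L[ℂ] E n :=
  diagOp fun i => ((weight d z i : ℝ) : ℂ)⁻¹

theorem norm_unscale_le (hd : ∀ i, 0 < d i) (f : PolySystem d) {z : E (n + 1)} (hz : z ≠ 0)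
    {r : E n} {c : ℝ} (hc : 0 ≤ c)
    (h : ∀ i, ‖r i‖ ≤ weight d z i * (c * polyWeyl (f i).1)) :
    ‖unscale d z r‖ ≤ c * weylNorm f := by
  rw [weylNorm_eq, EuclideanSpace.norm_eq]
  nth_rewrite 1 [← Real.sqrt_sq hc]
  rw [← Real.sqrt_mul (sq_nonneg _), Finset.mul_sum]
  refine Real.sqrt_le_sqrt (Finset.sum_le_sum fun i _ => ?_)
  have hw := weight_pos hd hz i
  rw [unscale, diagOp_apply, norm_mul, norm_inv, Complex.norm_real, Real.norm_of_nonneg hw.le,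
    ← mul_pow]
  refine pow_le_pow_left₀ (by positivity) ?_ 2
  rw [inv_mul_le_iff₀ hw]
  exact h i

/-- The condition number without the factor `‖f‖`. -/
noncomputable def invNorm (f : PolySystem d) (z : E (n + 1)) : ℝ :=
  ‖(jacobianPerp f z).inverse ∘L diagOp fun i => ((√(d i) * ‖z‖ ^ (d i - 1) : ℝ) : ℂ)‖

theorem invNorm_nonneg (f : PolySystem d) (z : E (n + 1)) : 0 ≤ invNorm f z := by
  rw [invNorm]
  positivity

/-- The condition number enters as a lower bound for the derivative, a form that survives
perturbation by the triangle inequality. -/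
theorem norm_le_invNorm_mul (hd : ∀ i, 0 < d i) (f : PolySystem d) {z : E (n + 1)} (hz : z ≠ 0)
    (hinv : (jacobianPerp f z).IsInvertible) {u : E (n + 1)} (hu : u ∈ (Submodule.span ℂ {z})ᗮ) :
    ‖u‖ ≤ invNorm f z * ‖unscale d z (jacobian f z u)‖ := by
  have h1 : (diagOp fun i => ((√(d i) * ‖z‖ ^ (d i - 1) : ℝ) : ℂ))
      (unscale d z (jacobian f z u)) = jacobian f z u := by
    ext i
    rw [unscale, diagOp_apply, diagOp_apply]
    have : ((weight d z i : ℝ) : ℂ) ≠ 0 := by exact_mod_cast (weight_pos hd hz i).ne'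
    exact mul_inv_cancel_left₀ this _
  have h2 : (jacobianPerp f z).inverse (jacobian f z u) = ⟨u, hu⟩ :=
    hinv.inverse_apply_eq.mpr rfl
  have h3 := ((jacobianPerp f z).inverse ∘L
    diagOp fun i => ((√(d i) * ‖z‖ ^ (d i - 1) : ℝ) : ℂ)).le_opNorm
      (unscale d z (jacobian f z u))
  rw [ContinuousLinearMap.comp_apply, h1, h2] at h3
  exact h3

/-- `D^{3/2}`. -/
noncomputable def degFactor (d : Fin n → ℕ) : ℝ := (maxDegree d : ℝ) ^ (3 / 2 : ℝ)

theorem degFactor_nonneg (d : Fin n → ℕ) : 0 ≤ degFactor d :=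
  Real.rpow_nonneg (Nat.cast_nonneg _) _

theorem mul_sqrt_le_degFactor (d : Fin n → ℕ) (i : Fin n) :
    (d i : ℝ) * √(d i) ≤ degFactor d := by
  have h : (d i : ℝ) * √(d i) = (d i : ℝ) ^ (3 / 2 : ℝ) := by
    rw [show (3 / 2 : ℝ) = 1 + 1 / 2 by norm_num,
      Real.rpow_add_of_nonneg (Nat.cast_nonneg _) (by norm_num) (by norm_num), Real.rpow_one,
      Real.sqrt_eq_rpow]
  rw [h, degFactor]
  gcongr
  exact Finset.le_sup (f := d) (Finset.mem_univ i)

theorem sqrt_le_degFactor (hd : ∀ i, 0 < d i) (i : Fin n) : √(d i) ≤ degFactor d := by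
  refine le_trans ?_ (mul_sqrt_le_degFactor d i)
  have : (1 : ℝ) ≤ d i := by exact_mod_cast hd i
  exact le_mul_of_one_le_left (Real.sqrt_nonneg _) this

/-- The exponent 3/2 originates here: of `dᵢ²`, a factor `dᵢ^{1/2}` is absorbed by the weight. The
surplus power of `‖z‖` is harmless because `‖z‖ ≥ 1`. -/
theorem second_order_le_weight {z : E (n + 1)} (hz : 1 ≤ ‖z‖) (i : Fin n)
    {a b W : ℝ} (ha : 0 ≤ a) (hb : 0 ≤ b) (hW : 0 ≤ W) :
    (d i - 1 : ℕ) * a * (d i * b * W) * ‖z‖ ^ (d i - 1 - 1) ≤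
      weight d z i * (degFactor d * a * b * W) := by
  have h1 : ((d i - 1 : ℕ) : ℝ) * d i ≤ √(d i) * degFactor d := by
    have h2 : ((d i - 1 : ℕ) : ℝ) ≤ d i := by exact_mod_cast Nat.sub_le _ _
    calc ((d i - 1 : ℕ) : ℝ) * d i ≤ d i * d i := by gcongr
      _ = √(d i) * (d i * √(d i)) := by
        rw [mul_left_comm, Real.mul_self_sqrt (Nat.cast_nonneg _)]
      _ ≤ _ := by
        gcongr
        exact mul_sqrt_le_degFactor d i
  have h3 : ‖z‖ ^ (d i - 1 - 1) ≤ ‖z‖ ^ (d i - 1) := pow_le_pow_right₀ hz (Nat.sub_le _ _)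
  have hD := degFactor_nonneg d
  calc _ = (((d i - 1 : ℕ) : ℝ) * d i) * ‖z‖ ^ (d i - 1 - 1) * (a * b * W) := by ring
    _ ≤ (√(d i) * degFactor d) * ‖z‖ ^ (d i - 1) * (a * b * W) := by gcongr
    _ = _ := by rw [weight]; ring

theorem mem_orthogonal_span_iff {x v : E (n + 1)} :
    v ∈ (Submodule.span ℂ {x})ᗮ ↔ inner ℂ x v = 0 :=
  Submodule.mem_orthogonal_singleton_iff_inner_right

theorem norm_add_sq_of_unit {x w : E (n + 1)} (hx : ‖x‖ = 1) (hw : inner ℂ x w = 0) :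
    ‖x + w‖ ^ 2 = 1 + ‖w‖ ^ 2 := by
  have e1 := norm_add_sq_eq_norm_sq_add_norm_sq_of_inner_eq_zero x w hw
  rw [hx] at e1
  linarith

theorem one_le_norm_add {x w : E (n + 1)} (hx : ‖x‖ = 1) (hw : inner ℂ x w = 0) :
    1 ≤ ‖x + w‖ := by
  nlinarith [norm_add_sq_of_unit hx hw, norm_nonneg (x + w), sq_nonneg ‖w‖]

/-- The derivatives at `x` and at `x + w` are close. -/
theorem norm_unscale_jacobian_sub_le (hd : ∀ i, 0 < d i) (f : PolySystem d) {x w : E (n + 1)}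
    (hx : ‖x‖ = 1) (hw : inner ℂ x w = 0) (v : E (n + 1)) :
    ‖unscale d (x + w) (jacobian f (x + w) v - jacobian f x v)‖ ≤
      degFactor d * ‖w‖ * ‖v‖ * weylNorm f := by
  have hz1 := one_le_norm_add hx hw
  have hz : x + w ≠ 0 := norm_pos_iff.mp (by linarith)
  have hD := degFactor_nonneg d
  refine norm_unscale_le hd f hz (by positivity) fun i => ?_
  have := norm_eval_dirDeriv_sub_le (system_isHomogeneous f i) hw v zero_le_one le_rfl
  rw [one_smul] at this
  rw [PiLp.sub_apply, jacobian_apply, jacobian_apply]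
  exact this.trans (second_order_le_weight hz1 i (norm_nonneg _) (norm_nonneg _)
    (polyWeyl_nonneg _))

/-- The remainder of the first order Taylor formula. -/
theorem norm_unscale_taylor_le (hd : ∀ i, 0 < d i) (f : PolySystem d) {x w : E (n + 1)}
    (hx : ‖x‖ = 1) (hw : inner ℂ x w = 0) :
    ‖unscale d (x + w) (evalSystem f (x + w) - evalSystem f x - jacobian f x w)‖ ≤
      degFactor d * ‖w‖ * ‖w‖ * weylNorm f := by
  have hz1 := one_le_norm_add hx hw
  have hz : x + w ≠ 0 := norm_pos_iff.mp (by linarith)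
  have hD := degFactor_nonneg d
  refine norm_unscale_le hd f hz (by positivity) fun i => ?_
  rw [PiLp.sub_apply, PiLp.sub_apply, jacobian_apply]
  exact (norm_eval_taylor_le (system_isHomogeneous f i) hw).trans
    (second_order_le_weight hz1 i (norm_nonneg _) (norm_nonneg _) (polyWeyl_nonneg _))

/-- The scaled condition number `D^{3/2} ‖f‖ ‖(Df(z)|_{z^⊥})⁻¹ Δ‖`. -/
noncomputable def scaledCond (f : PolySystem d) (z : E (n + 1)) : ℝ :=
  degFactor d * (weylNorm f * invNorm f z)

/-- Compare the upper and lower bounds of the derivative at one nonzero vector of `z^⊥`, which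
exists because `n ≠ 0`. This turns smallness relative to the condition number into absolute
smallness of the angle. -/
theorem one_le_scaledCond (hd : ∀ i, 0 < d i) (hn : n ≠ 0) (f : PolySystem d) {z : E (n + 1)}
    (hz : z ≠ 0) (hinv : (jacobianPerp f z).IsInvertible) : 1 ≤ scaledCond f z := by
  have hfr : Module.finrank ℂ (Submodule.span ℂ {z})ᗮ = n := by
    have : Fact (Module.finrank ℂ (E (n + 1)) = n + 1) := ⟨by simp⟩
    exact Submodule.finrank_orthogonal_span_singleton hz
  have : Nontrivial (Submodule.span ℂ {z})ᗮ :=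
    Module.nontrivial_of_finrank_pos (R := ℂ) (by omega)
  obtain ⟨⟨u, hu⟩, hu0⟩ := exists_ne (0 : (Submodule.span ℂ {z})ᗮ)
  have hu0 : 0 < ‖u‖ := norm_pos_iff.mpr fun h => hu0 (Subtype.ext h)
  have hD := degFactor_nonneg d
  have h1 : ‖unscale d z (jacobian f z u)‖ ≤ degFactor d * ‖u‖ * weylNorm f := by
    refine norm_unscale_le hd f hz (by positivity) fun i => ?_
    have hW := polyWeyl_nonneg (f i).1
    rw [jacobian_apply]
    refine (norm_eval_dirDeriv_le (system_isHomogeneous f i) z u).trans ?_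
    calc (d i : ℝ) * ‖u‖ * polyWeyl (f i).1 * ‖z‖ ^ (d i - 1)
        = √(d i) * ‖z‖ ^ (d i - 1) * (√(d i) * ‖u‖ * polyWeyl (f i).1) := by
          nth_rewrite 1 [← Real.mul_self_sqrt (Nat.cast_nonneg (α := ℝ) (d i))]
          ring
      _ ≤ _ := by
          rw [weight]
          gcongr
          exact sqrt_le_degFactor hd i
  have h2 := norm_le_invNorm_mul hd f hz hinv hu
  have h3 : 1 * ‖u‖ ≤ scaledCond f z * ‖u‖ := by
    rw [one_mul]
    refine h2.trans ((mul_le_mul_of_nonneg_left h1 (invNorm_nonneg f z)).trans (le_of_eq ?_))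
    rw [scaledCond]
    ring
  exact le_of_mul_le_mul_right h3 hu0

/-! ### Lower bounds for the derivative and the Newton step in a chart. -/

/-- At a zero `x + w`, the derivative is bounded below on `x^⊥`. -/
theorem norm_le_of_mem_orthogonal (hd : ∀ i, 0 < d i) (f : PolySystem d) {x w : E (n + 1)}
    (hx : ‖x‖ = 1) (hw : inner ℂ x w = 0) (hzero : evalSystem f (x + w) = 0)
    (hinv : (jacobianPerp f (x + w)).IsInvertible) {v : E (n + 1)} (hv : inner ℂ x v = 0) :
    ‖x + w‖⁻¹ * ‖v‖ ≤
      invNorm f (x + w) * ‖unscale d (x + w) (jacobian f (x + w) v)‖ := by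
  have hz1 := one_le_norm_add hx hw
  have hzsq := norm_add_sq_of_unit hx hw
  have hxv : inner ℂ (x + w) v = inner ℂ w v := by rw [inner_add_left, hv, zero_add]
  have hz0 := jacobian_self_eq_zero f hzero
  generalize x + w = z at *
  have hz : z ≠ 0 := norm_pos_iff.mp (by linarith)
  have hzp : 0 < ‖z‖ := by linarith
  have hzc : inner ℂ z z ≠ 0 := inner_self_ne_zero.mpr hz
  -- The component of `v` along `z` is killed by `Df(z)`, so only the projection to `z^⊥` matters.
  set a : ℂ := inner ℂ z v / inner ℂ z z with ha
  have hu : inner ℂ z (v - a • z) = 0 := by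
    rw [inner_sub_right, inner_smul_right, ha, div_mul_cancel₀ _ hzc, sub_self]
  have h1 := norm_le_invNorm_mul hd f hz hinv (mem_orthogonal_span_iff.mpr hu)
  rw [map_sub, map_smul, hz0, smul_zero, sub_zero] at h1
  refine le_trans ?_ h1
  have hpy : ‖v‖ ^ 2 = ‖v - a • z‖ ^ 2 + ‖a • z‖ ^ 2 := by
    have := norm_add_sq_eq_norm_sq_add_norm_sq_of_inner_eq_zero (a • z) (v - a • z)
      (by rw [inner_smul_left, hu, mul_zero])
    rw [add_sub_cancel] at this
    linarith
  -- As `v ⊥ x`, the product of `z` with `v` is that of `w` with `v`. With `‖z‖² - ‖w‖² = 1` this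
  -- shows that the projection shrinks `v` by at most `‖z‖⁻¹`.
  have haz : ‖a • z‖ * ‖z‖ ≤ ‖w‖ * ‖v‖ := by
    have : ‖a • z‖ * ‖z‖ = ‖inner ℂ w v‖ := by
      rw [norm_smul, ha, norm_div, hxv, inner_self_eq_norm_sq_to_K, norm_pow]
      simp only [Complex.coe_algebraMap, Complex.norm_real, norm_norm]
      field_simp
    rw [this]
    exact norm_inner_le_norm w v
  rw [inv_mul_le_iff₀ hzp]
  refine (sq_le_sq₀ (norm_nonneg _) (by positivity)).mp ?_
  have h2 : (‖a • z‖ * ‖z‖) ^ 2 ≤ (‖w‖ * ‖v‖) ^ 2 := by gcongr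
  have h3 : (‖z‖ * ‖v - a • z‖) ^ 2 = ‖z‖ ^ 2 * ‖v‖ ^ 2 - (‖a • z‖ * ‖z‖) ^ 2 := by
    rw [hpy]; ring
  rw [h3, hzsq]
  nlinarith

/-- The derivative at `x` is bounded below on `x^⊥`. -/
theorem sub_mul_norm_le (hd : ∀ i, 0 < d i) (f : PolySystem d) {x w : E (n + 1)}
    (hx : ‖x‖ = 1) (hw : inner ℂ x w = 0) (hzero : evalSystem f (x + w) = 0)
    (hinv : (jacobianPerp f (x + w)).IsInvertible) {v : E (n + 1)} (hv : inner ℂ x v = 0) :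
    (‖x + w‖⁻¹ - scaledCond f (x + w) * ‖w‖) * ‖v‖ ≤
      invNorm f (x + w) * ‖unscale d (x + w) (jacobian f x v)‖ := by
  have h1 := norm_le_of_mem_orthogonal hd f hx hw hzero hinv hv
  have h2 := norm_unscale_jacobian_sub_le hd f hx hw v
  rw [map_sub] at h2
  have h3 := (norm_sub_norm_le _ _).trans h2
  have h4 := mul_le_mul_of_nonneg_left h3 (invNorm_nonneg f (x + w))
  rw [sub_mul, scaledCond]
  linarith

theorem jacobianPerp_isInvertible_of_injective (f : PolySystem d) {x : E (n + 1)} (hx : x ≠ 0)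
    (h : ∀ v, inner ℂ x v = 0 → jacobian f x v = 0 → v = 0) :
    (jacobianPerp f x).IsInvertible := by
  have hfr : Module.finrank ℂ (Submodule.span ℂ {x})ᗮ = Module.finrank ℂ (E n) := by
    have : Fact (Module.finrank ℂ (E (n + 1)) = n + 1) := ⟨by simp⟩
    rw [Submodule.finrank_orthogonal_span_singleton (n := n) hx]
    simp
  have hinj : Function.Injective (jacobianPerp f x).toLinearMap := by
    rw [← LinearMap.ker_eq_bot, LinearMap.ker_eq_bot']
    rintro ⟨v, hv⟩ hv0
    exact Subtype.ext (h v (mem_orthogonal_span_iff.mp hv) hv0)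
  refine ⟨(LinearMap.linearEquivOfInjective _ hinj hfr).toContinuousLinearEquiv, ?_⟩
  ext v : 1
  rfl

/-- The Newton iterate, measured in the affine chart of the lines not orthogonal to `x`. -/
theorem newtonVec_sub_norm_le (hd : ∀ i, 0 < d i) (f : PolySystem d) {x w : E (n + 1)}
    (hx : ‖x‖ = 1) (hw : inner ℂ x w = 0) (hzero : evalSystem f (x + w) = 0)
    (hinv : (jacobianPerp f (x + w)).IsInvertible)
    (hpos : 0 < ‖x + w‖⁻¹ - scaledCond f (x + w) * ‖w‖) :
    (jacobianPerp f x).IsInvertible ∧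
      (‖x + w‖⁻¹ - scaledCond f (x + w) * ‖w‖) * ‖newtonVec f x - (x + w)‖ ≤
        scaledCond f (x + w) * ‖w‖ ^ 2 := by
  have hx0 : x ≠ 0 := norm_pos_iff.mp (by rw [hx]; exact one_pos)
  have hI : (jacobianPerp f x).IsInvertible := by
    refine jacobianPerp_isInvertible_of_injective f hx0 fun v hv hv0 => ?_
    have := sub_mul_norm_le hd f hx hw hzero hinv hv
    rw [hv0, map_zero, norm_zero, mul_zero] at this
    exact norm_le_zero_iff.mp (by nlinarith [norm_nonneg v])
  refine ⟨hI, ?_⟩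
  set a := (jacobianPerp f x).inverse (evalSystem f x) with ha
  have hJ : jacobian f x (a : E (n + 1)) = evalSystem f x :=
    (hI.inverse_apply_eq.mp ha.symm).symm
  have hdiff : newtonVec f x - (x + w) = -((a : E (n + 1)) + w) := by
    rw [newtonVec]; abel
  have hperp : inner ℂ x (newtonVec f x - (x + w)) = 0 := by
    rw [hdiff, inner_neg_right, inner_add_right, mem_orthogonal_span_iff.mp a.2, hw, add_zero,
      neg_zero]
  have h1 := sub_mul_norm_le hd f hx hw hzero hinv hperp
  -- The Newton equation cancels `f(x)`, leaving exactly the Taylor remainder since `f` vanishes at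
  -- `x + w`.
  have hR : jacobian f x (newtonVec f x - (x + w)) =
      evalSystem f (x + w) - evalSystem f x - jacobian f x w := by
    rw [hdiff, map_neg, map_add, hJ, hzero]
    abel
  rw [hR] at h1
  have h2 := mul_le_mul_of_nonneg_left (norm_unscale_taylor_le hd f hx hw)
    (invNorm_nonneg f (x + w))
  refine h1.trans (h2.trans (le_of_eq ?_))
  rw [scaledCond]
  ring

/-- The sine of the angle is the distance from `z` to the line of `y`, divided by `‖z‖ ≥ 1`;
Jordan's inequality then bounds the angle by its sine. -/
theorem lineAngle_le_mul_norm_sub {y z : E (n + 1)} (hy : y ≠ 0) (hz : 1 ≤ ‖z‖) :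
    lineAngle y z ≤ Real.pi / 2 * ‖y - z‖ := by
  have hyp : 0 < ‖y‖ := norm_pos_iff.mpr hy
  have hzp : 0 < ‖z‖ := by linarith
  -- The Gram determinant is unchanged when `z` is replaced by `z - y`.
  have hgram : (‖y‖ * ‖z‖) ^ 2 - ‖inner ℂ y z‖ ^ 2 ≤ ‖y‖ ^ 2 * ‖y - z‖ ^ 2 := by
    have h1 := norm_add_sq (𝕜 := ℂ) y (z - y)
    have h2 : inner ℂ y z = (‖y‖ : ℂ) ^ 2 + inner ℂ y (z - y) := by
      rw [inner_sub_right, inner_self_eq_norm_sq_to_K]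
      simp
    have h3 : ‖inner ℂ y z‖ ^ 2 = (‖y‖ ^ 2 + (inner ℂ y (z - y)).re) ^ 2 +
        (inner ℂ y (z - y)).im ^ 2 := by
      rw [h2, Complex.sq_norm, Complex.normSq_apply]
      simp [← Complex.ofReal_pow]
      ring
    rw [add_sub_cancel] at h1
    simp only [RCLike.re_to_complex] at h1
    rw [h3, norm_sub_rev y z, mul_pow, h1]
    nlinarith [sq_nonneg (inner ℂ y (z - y)).re, sq_nonneg (inner ℂ y (z - y)).im]
  set c := ‖inner ℂ y z‖ / (‖y‖ * ‖z‖) with hc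
  have hc0 : 0 ≤ c := by positivity
  have hsin : Real.sin (lineAngle y z) ≤ ‖y - z‖ := by
    rw [lineAngle, Real.sin_arccos, Real.sqrt_le_left (norm_nonneg _), div_pow]
    have : 1 - ‖inner ℂ y z‖ ^ 2 / (‖y‖ * ‖z‖) ^ 2 =
        ((‖y‖ * ‖z‖) ^ 2 - ‖inner ℂ y z‖ ^ 2) / (‖y‖ * ‖z‖) ^ 2 := by
      field_simp
    rw [this, div_le_iff₀ (by positivity)]
    refine hgram.trans ?_
    have : ‖y‖ ^ 2 * ‖y - z‖ ^ 2 * 1 ≤ ‖y‖ ^ 2 * ‖y - z‖ ^ 2 * ‖z‖ ^ 2 := by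
      gcongr
      exact one_le_pow₀ hz
    linarith
  have hj := Real.mul_le_sin (Real.arccos_nonneg c) (Real.arccos_le_pi_div_two.mpr hc0)
  have hpi := Real.pi_pos
  have := hj.trans hsin
  calc lineAngle y z = Real.pi / 2 * (2 / Real.pi * Real.arccos c) := by
        rw [lineAngle, ← hc]; field_simp
    _ ≤ _ := by gcongr

theorem u0_pos : 0 < u0 := by
  have h : √224 < 16 := by rw [Real.sqrt_lt' (by norm_num)]; norm_num
  unfold u0
  linarith

theorem u0_lt : u0 < 65 / 1000 := by
  have h : 1496 / 100 < √224 := Real.lt_sqrt_of_sq_lt (by norm_num)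
  unfold u0
  linarith

/-- One step of Newton's method, for representatives in the same affine chart. -/
theorem newtonVec_lineAngle_le_of_chart (hd : ∀ i, 0 < d i) (hn : n ≠ 0) (f : PolySystem d)
    {x w z : E (n + 1)} (hx : ‖x‖ = 1) (hw : inner ℂ x w = 0) (hzw : z = x + w)
    (hzero : evalSystem f z = 0) (hinv : (jacobianPerp f z).IsInvertible)
    (hsmall : scaledCond f z * lineAngle x z < u0) :
    (jacobianPerp f x).IsInvertible ∧
      2 * u0 * lineAngle (newtonVec f x) z ≤ scaledCond f z * lineAngle x z ^ 2 := by
  subst hzw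
  have hx0 : x ≠ 0 := norm_pos_iff.mp (by rw [hx]; exact one_pos)
  have hz1 := one_le_norm_add hx hw
  have hzsq := norm_add_sq_of_unit hx hw
  have hzp : 0 < ‖x + w‖ := by linarith
  have hM := one_le_scaledCond hd hn f (norm_pos_iff.mp hzp) hinv
  have hang : lineAngle x (x + w) = Real.arccos ‖x + w‖⁻¹ := by
    rw [lineAngle, inner_add_right, hw, inner_self_eq_norm_sq_to_K, hx]
    simp
  have hδ0 : 0 ≤ lineAngle x (x + w) := Real.arccos_nonneg _
  have hcos : Real.cos (lineAngle x (x + w)) = ‖x + w‖⁻¹ := by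
    rw [hang, Real.cos_arccos (by have := inv_pos.mpr hzp; linarith) (inv_le_one_of_one_le₀ hz1)]
  have hsin : Real.sin (lineAngle x (x + w)) = ‖w‖ * ‖x + w‖⁻¹ := by
    rw [hang, Real.sin_arccos, Real.sqrt_eq_iff_eq_sq (by
      have := inv_le_one_of_one_le₀ hz1
      have := inv_pos.mpr hzp
      nlinarith) (by positivity)]
    field_simp
    linarith
  have hcos_ge := Real.one_sub_sq_div_two_le_cos (x := lineAngle x (x + w))
  have hsin_le := Real.sin_le hδ0
  rw [hcos] at hcos_ge
  rw [hsin] at hsin_le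
  have key := newtonVec_sub_norm_le hd f hx hw hzero hinv
  have hang' := lineAngle_le_mul_norm_sub (newtonVec_ne_zero f hx0) hz1
  have hu := u0_lt
  have hu' := u0_pos
  have hpi := Real.pi_lt_d2
  have hpi0 := Real.pi_pos
  set M := scaledCond f (x + w)
  set δ := lineAngle x (x + w)
  set c := ‖x + w‖⁻¹
  set t := ‖w‖
  set N := ‖newtonVec f x - (x + w)‖
  have ht : 0 ≤ t := norm_nonneg _
  have hN : 0 ≤ N := norm_nonneg _
  -- From `M ≥ 1` and `M δ < u₀`. The decimals below are rounded with slack: `1.6 * 1.1 / 0.9 < 2`,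
  -- where 1.6 exceeds π/2.
  have hδ : δ ≤ 65 / 1000 := by nlinarith
  have hc : 99 / 100 ≤ c := by nlinarith
  have htδ : t ≤ 102 / 100 * δ := by nlinarith
  have hMt : M * t ≤ 7 / 100 := by nlinarith
  have hden : 9 / 10 ≤ c - M * t := by linarith
  obtain ⟨hI, hle⟩ := key (by linarith)
  refine ⟨hI, ?_⟩
  have h1 : 9 / 10 * N ≤ M * t ^ 2 := (mul_le_mul_of_nonneg_right hden hN).trans hle
  have h2 : t ^ 2 ≤ 11 / 10 * δ ^ 2 := by nlinarith
  have h3 : M * t ^ 2 ≤ M * (11 / 10 * δ ^ 2) := by gcongr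
  have h4 : lineAngle (newtonVec f x) (x + w) ≤ 16 / 10 * N :=
    hang'.trans (mul_le_mul_of_nonneg_right (by linarith) hN)
  have h5 : 0 ≤ M * δ ^ 2 := by positivity
  have h6 : lineAngle (newtonVec f x) (x + w) ≤ 2 * (M * δ ^ 2) := by linarith
  have h7 : 0 ≤ lineAngle (newtonVec f x) (x + w) := Real.arccos_nonneg _
  -- It remains to use `4 * u0 ≤ 1`.
  nlinarith

/-! ### From charts to arbitrary representatives. -/

/-- Two lines that are not orthogonal have representatives in the same affine chart. -/
theorem exists_chart {x z : E (n + 1)} (h : inner ℂ x z ≠ 0) :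
    ∃ s t : ℂ, s ≠ 0 ∧ t ≠ 0 ∧ ‖s • x‖ = 1 ∧ ∃ w, inner ℂ (s • x) w = 0 ∧ t • z = s • x + w := by
  have hx : x ≠ 0 := by rintro rfl; simp at h
  have hs : ((‖x‖ : ℂ)⁻¹) ≠ 0 := by simpa using hx
  have hs1 : ‖((‖x‖ : ℂ)⁻¹) • x‖ = 1 := by
    rw [norm_smul, norm_inv, Complex.norm_real, norm_norm, inv_mul_cancel₀ (norm_ne_zero_iff.mpr hx)]
  have h' : inner ℂ (((‖x‖ : ℂ)⁻¹) • x) z ≠ 0 := by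
    rw [inner_smul_left]
    exact mul_ne_zero (by simpa using hx) h
  refine ⟨_, (inner ℂ (((‖x‖ : ℂ)⁻¹) • x) z)⁻¹, hs, inv_ne_zero h', hs1,
    (inner ℂ (((‖x‖ : ℂ)⁻¹) • x) z)⁻¹ • z - ((‖x‖ : ℂ)⁻¹) • x, ?_, by abel⟩
  rw [inner_sub_right, inner_smul_right, inv_mul_cancel₀ h', inner_self_eq_norm_sq_to_K, hs1]
  simp

theorem muNormVec_of_isInvertible (f : PolySystem d) {z : E (n + 1)}
    (hinv : (jacobianPerp f z).IsInvertible) :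
    muNormVec f z = ENNReal.ofReal (weylNorm f * invNorm f z) := by
  rw [muNormVec, if_pos hinv]
  rfl

theorem scaledCond_eq (f : PolySystem d) {z : E (n + 1)}
    (hinv : (jacobianPerp f z).IsInvertible) :
    scaledCond f z = degFactor d * (muNormVec f z).toReal := by
  rw [muNormVec_of_isInvertible f hinv, scaledCond,
    ENNReal.toReal_ofReal (mul_nonneg (weylNorm_nonneg f) (invNorm_nonneg f z))]

theorem isInvertible_of_muNormVec_ne_top (f : PolySystem d) {z : E (n + 1)}
    (h : muNormVec f z ≠ ∞) : (jacobianPerp f z).IsInvertible := by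
  by_contra hc
  exact h (by rw [muNormVec, if_neg hc])

/-- One step of Newton's method. -/
theorem newtonVec_lineAngle_le (hd : ∀ i, 0 < d i) (hn : n ≠ 0) (f : PolySystem d)
    {x z : E (n + 1)} (hz : z ≠ 0) (hzero : evalSystem f z = 0) (hmu : muNormVec f z ≠ ∞)
    (hsmall : degFactor d * (muNormVec f z).toReal * lineAngle x z < u0) :
    (jacobianPerp f x).IsInvertible ∧
      2 * u0 * lineAngle (newtonVec f x) z ≤
        degFactor d * (muNormVec f z).toReal * lineAngle x z ^ 2 := by
  -- Orthogonal lines are at angle π/2, which exceeds `u0`, while the condition factor is at least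
  -- 1.
  have hxz : inner ℂ x z ≠ 0 := by
    intro h
    have hM := one_le_scaledCond hd hn f hz (isInvertible_of_muNormVec_ne_top f hmu)
    rw [scaledCond_eq f (isInvertible_of_muNormVec_ne_top f hmu)] at hM
    have hang : lineAngle x z = Real.pi / 2 := by simp [lineAngle, h]
    rw [hang] at hsmall
    nlinarith [Real.pi_gt_three, u0_lt]
  obtain ⟨s, t, hs, ht, hs1, w, hw, hzw⟩ := exists_chart hxz
  have hmu' : muNormVec f (t • z) = muNormVec f z := by
    simpa using muNormVec_smul f z one_ne_zero ht
  have hang : lineAngle (s • x) (t • z) = lineAngle x z := lineAngle_smul x z hs ht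
  have hN : newtonVec f (s • x) = s • newtonVec f x := by
    simpa using newtonVec_smul hd f x one_ne_zero hs
  have hI := jacobianPerp_smul_isInvertible f x one_ne_zero hs
  rw [one_smul] at hI
  have hzero' : evalSystem f (t • z) = 0 := by
    have := evalSystem_smul f z 1 t
    rwa [one_smul, hzero, map_zero] at this
  have hinv' := isInvertible_of_muNormVec_ne_top f (hmu'.trans_ne hmu)
  have hM : degFactor d * (muNormVec f z).toReal = scaledCond f (t • z) := by
    rw [scaledCond_eq f hinv', hmu']
  have hang' := lineAngle_smul (newtonVec f x) z hs ht
  rw [hM, ← hang] at hsmall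
  have key := newtonVec_lineAngle_le_of_chart hd hn f hs1 hw hzw hzero' hinv' hsmall
  rw [hN, hang', hang, ← hM, hI] at key
  exact key

end NewtonStep

/-! ### Projective points and the iteration. -/

section Iteration

variable {n : ℕ} {d : Fin n → ℕ}

theorem dim_ne_zero_of_system {n : ℕ} {d : Fin n → ℕ} (f : ℙ ℂ (PolySystem d)) : n ≠ 0 := by
  rintro rfl
  exact f.rep_nonzero (Subsingleton.elim _ _)

theorem exists_mem_newton (hd : ∀ i, 0 < d i) (f : ℙ ℂ (PolySystem d)) (x ζ : ℙ ℂ (E (n + 1)))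
    (hζ : IsZero f ζ) (hmu : muNorm f ζ ≠ ∞)
    (hsmall : degFactor d * (muNorm f ζ).toReal * projDist x ζ < u0) :
    ∃ y ∈ newton f x, 2 * u0 * projDist y ζ ≤
      degFactor d * (muNorm f ζ).toReal * projDist x ζ ^ 2 := by
  obtain ⟨hI, hle⟩ :=
    newtonVec_lineAngle_le hd (dim_ne_zero_of_system f) f.rep ζ.rep_nonzero hζ hmu hsmall
  refine ⟨_, ⟨hI, rfl⟩, ?_⟩
  have h := projDist_mk (newtonVec_ne_zero f.rep x.rep_nonzero) ζ.rep_nonzero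
  rw [Projectivization.mk_rep] at h
  change 2 * u0 * projDist (Projectivization.mk ℂ _ (newtonVec_ne_zero f.rep x.rep_nonzero)) ζ ≤ _
  rw [h]
  exact hle

end Iteration

end ProjNewton

theorem theorem5 {n : ℕ} {d : Fin n → ℕ} (hd : ∀ i, 0 < d i)
    (f : ℙ ℂ (ProjNewton.PolySystem d)) (x ζ : ℙ ℂ (ProjNewton.E (n + 1)))
    (hζ : ProjNewton.IsZero f ζ)
    (hx : ENNReal.ofReal (ProjNewton.projDist x ζ) <
      ENNReal.ofReal ProjNewton.u0 /
        (ENNReal.ofReal ((ProjNewton.maxDegree d : ℝ) ^ (3 / 2 : ℝ)) * ProjNewton.muNorm f ζ)) :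
    ∀ k : ℕ, ∃ y ∈ ProjNewton.newtonIter f k x,
      ProjNewton.projDist y ζ ≤ 1 / 2 ^ (2 ^ k - 1) * ProjNewton.projDist x ζ := by
  have hu := ProjNewton.u0_pos
  have hD : 0 < ProjNewton.degFactor d := by
    have h0 := Nat.pos_of_ne_zero (ProjNewton.dim_ne_zero_of_system f)
    refine lt_of_lt_of_le ?_ (ProjNewton.sqrt_le_degFactor hd ⟨0, h0⟩)
    exact Real.sqrt_pos.mpr (by exact_mod_cast hd _)
  change _ < _ / (ENNReal.ofReal (ProjNewton.degFactor d) * _) at hx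
  -- An infinite condition number makes the radius `u0 / ∞ = 0`, and no distance is below it.
  have hmu : ProjNewton.muNorm f ζ ≠ ∞ := by
    intro h
    rw [h, ENNReal.mul_top (ENNReal.ofReal_pos.mpr hD).ne', ENNReal.div_top] at hx
    exact not_lt_zero hx
  have hx0 : 0 ≤ ProjNewton.projDist x ζ := Real.arccos_nonneg _
  have hsmall : ProjNewton.degFactor d * (ProjNewton.muNorm f ζ).toReal *
      ProjNewton.projDist x ζ < ProjNewton.u0 := by
    rw [ENNReal.lt_div_iff_mul_lt (.inr ENNReal.ofReal_ne_top)
      (.inl (ENNReal.mul_ne_top ENNReal.ofReal_ne_top hmu)), ← ENNReal.ofReal_toReal hmu,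
      ← ENNReal.ofReal_mul hD.le, ← ENNReal.ofReal_mul hx0, ENNReal.ofReal_lt_ofReal_iff hu] at hx
    rw [mul_comm]
    exact hx
  set M := ProjNewton.degFactor d * (ProjNewton.muNorm f ζ).toReal with hM
  have hM0 : 0 ≤ M := mul_nonneg hD.le ENNReal.toReal_nonneg
  set δ := ProjNewton.projDist x ζ with hδ
  intro k
  induction k with
  | zero => exact ⟨x, Part.mem_some x, by simp [hδ]⟩
  | succ k ih =>
    obtain ⟨y, hy, hyd⟩ := ih
    have hy0 : 0 ≤ ProjNewton.projDist y ζ := Real.arccos_nonneg _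
    set q : ℝ := 1 / 2 ^ (2 ^ k - 1) with hq
    have hq0 : 0 < q := by positivity
    have hq1 : q ≤ 1 := by
      rw [hq]
      exact div_le_one_of_le₀ (one_le_pow₀ (by norm_num)) (by positivity)
    have hyx : ProjNewton.projDist y ζ ≤ δ := hyd.trans (mul_le_of_le_one_left hx0 hq1)
    obtain ⟨y', hy', hle⟩ := ProjNewton.exists_mem_newton hd f y ζ hζ hmu
      ((mul_le_mul_of_nonneg_left hyx hM0).trans_lt hsmall)
    refine ⟨y', Part.mem_bind hy hy', ?_⟩
    -- The contraction factor is squared by the quadratic estimate and halved by the constant `2 *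
    -- u0`, since `2^(k+1) - 1 = 2 (2^k - 1) + 1`.
    have hpow : (1 : ℝ) / 2 ^ (2 ^ (k + 1) - 1) = q ^ 2 / 2 := by
      have : 2 ^ (k + 1) - 1 = (2 ^ k - 1) * 2 + 1 := by
        have := Nat.one_le_two_pow (n := k)
        rw [pow_succ]
        omega
      rw [this, pow_succ, pow_mul, hq, div_pow, one_pow, div_div]
    rw [hpow]
    have h1 : M * ProjNewton.projDist y ζ ^ 2 ≤ M * (q * δ) ^ 2 := by gcongr
    -- One factor `δ` is spent on `M δ < u₀`; the other remains in the conclusion.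
    have h2 : M * (q * δ) ^ 2 ≤ ProjNewton.u0 * (q ^ 2 * δ) := by
      have := mul_le_mul_of_nonneg_right hsmall.le (by positivity : 0 ≤ q ^ 2 * δ)
      linarith
    have h3 := hle.trans (h1.trans h2)
    refine le_of_mul_le_mul_left (a := 2 * ProjNewton.u0) ?_ (by positivity)
    linarith
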